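/- Let $\hat\nu:\mathbb R\to\mathbb R$ be the constitutive law (tension $\mapsto$ stretch) of a uniform stretch-limited string: there are $N_0<0<N_1$ and $0<\nu_0<1<\nu_1$ such that $\hat\nu(N)=\nu_0$ for $N\le N_0$, $\hat\nu(N)=\nu_1$ for $N\ge N_1$, $\hat\nu\in C^\infty([N_0,N_1];[\nu_0,\nu_1])$, $\hat\nu(0)=1$, and $\hat\nu'\ge c$ on $[N_0,N_1]$ for some constant $c>0$. Let $g>0$ be the gravitational acceleration, and let $a>0$, $b\in\mathbb R$ satisfy $a^2+b^2<\nu_0^2$. For mass density $\gamma>0$ and $\lambda<0$, $\mu\in\mathbb R$ put $\delta(s)=\sqrt{\lambda^2+(\mu+g\gamma s)^2}$, $s\in[0,1]$. The compressive state with contact force $\lambda\,\boldsymbol i+\mu\,\boldsymbol k$ at $s=0$ has tension $-\delta(s)$ and stretch $\nu(s)=\hat\nu(-\delta(s))$, and it is an equilibrium suspended between the supports $\boldsymbol 0$ and $a\boldsymbol i+b\boldsymbol k$ if $$a\,\boldsymbol i+b\,\boldsymbol k=\int_0^1\frac{\hat\nu(-\delta(s))}{-\delta(s)}\bigl(\lambda\,\boldsymbol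 i+(\mu+g\gamma s)\,\boldsymbol k\bigr)\,ds.\qquad(1)$$ (i) The inextensible problem with unit mass density, that is, (1) with $\hat\nu$ replaced by the constant $1$ and $\gamma=1$, has exactly one solution $(\lambda_0,\mu_0)$ with $\lambda_0<0$, $\mu_0\in\mathbb R$. It is also the only pair $(\lambda,\mu)$ with $\lambda<0$, $\mu\in\mathbb R$ that satisfies $$\frac{\sqrt{1-b^2}}{a}=\frac{2|\lambda|}{ag}\sinh\frac{ag}{2|\lambda|},\qquad \mu=\lambda\sinh\Bigl(\frac{ag}{2|\lambda|}+\tanh^{-1}b\Bigr).$$ (ii) There is $\varepsilon>0$ such that for every $\gamma\in(0,\varepsilon)$ there is exactly one pair $(\lambda,\mu)=(\hat\lambda(\gamma),\hat\mu(\gamma))$ with $\lambda<0$, $\mu\in\mathbb R$ satisfying (1). Moreover, as $\gamma\to0^+$, $$\hat\lambda(\gamma)=\gamma\lambda_0+O(\gamma^2),\qquad \hat\mu(\gamma)=\gamma\mu_0+O(\gamma^2),$$ and $\varepsilon$ can be chosen such that for every $\gamma\in(0,\varepsilon)$ the string is completely extensible: the stretch $\nu(s)=\hat\nu(-\delta(s))$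 of this state lies in $(\nu_0,1)$ for all $s\in[0,1]$. -/

import Mathlib

open Set Filter Topology Asymptotics
open scoped ContDiff

/-- Constitutive law `N ↦ νhat N` (tension to stretch) of a uniform stretch-limited elastic string.
The stretch is constant equal to `ν₀` for tensions `N ≤ N₀`, constant equal to `ν₁` for `N ≥ N₁`,
and it is smooth with derivative bounded below by a positive constant on `[N₀, N₁]`
(one-sided derivatives at the end points). -/
structure IsStretchLimited (νhat : ℝ → ℝ) (N₀ N₁ ν₀ ν₁ : ℝ) : Prop where
  N₀_neg : N₀ < 0
  N₁_pos : 0 < N₁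
  /-- the stretch of a string is always positive -/
  ν₀_pos : 0 < ν₀
  ν₀_lt_one : ν₀ < 1
  one_lt_ν₁ : 1 < ν₁
  eq_of_le : ∀ N, N ≤ N₀ → νhat N = ν₀
  eq_of_ge : ∀ N, N₁ ≤ N → νhat N = ν₁
  mapsTo : MapsTo νhat (Icc N₀ N₁) (Icc ν₀ ν₁)
  contDiffOn : ContDiffOn ℝ ∞ νhat (Icc N₀ N₁)
  map_zero : νhat 0 = 1
  deriv_lower : ∃ c : ℝ, 0 < c ∧ ∀ N ∈ Icc N₀ N₁, c ≤ derivWithin νhat (Icc N₀ N₁) N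

/-- `δ(s) = √(λ² + (μ + g γ s)²)`, the magnitude at the material point `s` of the contact force
`λ i + (μ + g γ s) k` in a string of uniform mass density `γ` with contact force `λ i + μ k`
at the material point `0`. -/
noncomputable def contactMagnitude (g γ lam mu s : ℝ) : ℝ :=
  √(lam ^ 2 + (mu + g * γ * s) ^ 2)

/-- The stretch `ν(s) = νhat(N(s))` of the compressive state with force parameters `(λ, μ)`,
whose tension is `N(s) = -δ(s)`. -/
noncomputable def compressiveStretch (νhat : ℝ → ℝ) (g γ lam mu s : ℝ) : ℝ :=
  νhat (-contactMagnitude g γ lam mu s)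

/-- `(λ, μ)` solves the compressive catenary problem with supports `0` and `a i + b k`:
`a i + b k = ∫₀¹ νhat(-δ(s)) / (-δ(s)) (λ i + (μ + g γ s) k) ds`, written in components.
(For `λ ≠ 0`, which holds in every use below, the integrands are free of singularities.) -/
def SolvesCompressive (νhat : ℝ → ℝ) (g γ a b lam mu : ℝ) : Prop :=
  a = ∫ s in (0 : ℝ)..1,
    compressiveStretch νhat g γ lam mu s / (-contactMagnitude g γ lam mu s) * lam ∧
  b = ∫ s in (0 : ℝ)..1,
    compressiveStretch νhat g γ lam mu s / (-contactMagnitude g γ lam mu s) * (mu + g * γ * s)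

/-- `(λ, μ)` solves the compressive problem for the inextensible string, i.e. the one whose
stretch is `1` whatever the tension, with uniform mass density `γ`. -/
def SolvesInextensible (g γ a b lam mu : ℝ) : Prop :=
  SolvesCompressive (fun _ => 1) g γ a b lam mu

/-- The relations that determine the inextensible compressive catenary explicitly. -/
def ExplicitInextensible (g γ a b lam mu : ℝ) : Prop :=
  √(1 - b ^ 2) / a = 2 * |lam| / (a * g * γ) * Real.sinh (a * g * γ / (2 * |lam|)) ∧
  mu = lam * Real.sinh (a * g * γ / (2 * |lam|) + Real.artanh b)

/-! Put `z = -(λ + iμ)/γ` and `w_s = z - igs`. Then (1) becomes `F_γ(z) = a + ib`, where `F_γ(z) = ∫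
νhat(-γ|w_s|) w_s/|w_s| ds` is `supportMap` and `λ < 0` means `Re z > 0`. As `γ → 0`, `F_γ` tends to
the inextensible map `F₀(z) = ∫ w_s/|w_s| ds`, which no longer contains `γ`; this explains the
leading terms `γλ₀`, `γμ₀`.

`F₀` is the gradient of the convex function `z ↦ ∫ |w_s| ds`. Each `|w_s|` is degenerate only along
`w_s`, and for `Re z > 0` these directions vary with `s`, so `F₀` is strongly monotone
(`exists_stronglyMonotone_supportMap_one`). Since `νhat` is Lipschitz and `νhat(0) = 1`, both the
size and the Lipschitz constant of `F_γ - F₀` are `O(γ)` on bounded sets. Hence `F_γ` stays strongly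
monotone on a fixed ball about the inextensible solution `z₀`, and a contraction argument solves the
equation there. Uniqueness is global: testing with `z` bounds every solution because `|a + ib| < ν₀`
(`norm_le_of_supportMap_eq`), and monotonicity of `F₀` between such a solution and `z₀` puts it
within `O(γ)` of `z₀`.

In (i), elementary integration gives the explicit relations, the intermediate value theorem a
solution, and monotonicity of `F₀` its uniqueness. -/

/-! ### Solving equations with strongly monotone maps -/

/-- A strongly monotone Lipschitz map on a closed ball of a real Hilbert space attains every value
close enough to its value at the centre. -/
theorem exists_eq_of_stronglyMonotone {E : Type*} [NormedAddCommGroup E] [InnerProductSpace ℝ E]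
    [CompleteSpace E] {G : E → E} {z₀ p : E} {ρ c K : ℝ} (hρ : 0 ≤ ρ) (hc : 0 < c)
    (hmono : ∀ z ∈ Metric.closedBall z₀ ρ, ∀ z' ∈ Metric.closedBall z₀ ρ,
      c * ‖z - z'‖ ^ 2 ≤ inner ℝ (G z - G z') (z - z'))
    (hlip : ∀ z ∈ Metric.closedBall z₀ ρ, ∀ z' ∈ Metric.closedBall z₀ ρ,
      ‖G z - G z'‖ ≤ K * ‖z - z'‖)
    (hp : ‖G z₀ - p‖ ≤ c * ρ / 2) :
    ∃ z ∈ Metric.closedBall z₀ ρ, G z = p := by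
  have hz₀ : z₀ ∈ Metric.closedBall z₀ ρ := Metric.mem_closedBall_self hρ
  obtain ⟨C, hCK, hcC, hC⟩ : ∃ C : ℝ, K ≤ C ∧ c < C ∧ 0 < C :=
    ⟨max K (c + 1), le_max_left _ _, lt_of_lt_of_le (by linarith) (le_max_right _ _),
      lt_of_lt_of_le (by linarith) (le_max_right _ _)⟩
  set e : ℝ := c ^ 2 / C ^ 2 with he
  -- This step size minimises `1 - 2tc + t²C²`, the bound for the squared contraction factor of `z ↦
  -- z - t(G z - p)`; the minimum is `1 - e`.
  set t : ℝ := c / C ^ 2 with ht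
  have ht0 : 0 < t := by positivity
  have he0 : 0 < e := by positivity
  have he1 : e < 1 := by
    rw [he, div_lt_one (by positivity)]
    nlinarith
  have htc : t * c = e := by rw [ht, he]; ring
  have htC : t ^ 2 * C ^ 2 = e := by rw [ht, he]; field_simp
  -- `q² ≥ 1 - e` avoids a square root, and the remaining `e/2 = tc/2` is exactly what the
  -- hypothesis `c * ρ / 2` uses up to keep the ball invariant.
  set q : ℝ := 1 - e / 2 with hq
  have hq0 : 0 < q := by rw [hq]; linarith
  set T : E → E := fun z => z - t • (G z - p) with hT
  have hcontr : ∀ z ∈ Metric.closedBall z₀ ρ, ∀ z' ∈ Metric.closedBall z₀ ρ,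
      ‖T z - T z'‖ ≤ q * ‖z - z'‖ := by
    intro z hz z' hz'
    have h1 : T z - T z' = (z - z') - t • (G z - G z') := by
      simp only [hT, smul_sub]; abel
    have h2 : ‖T z - T z'‖ ^ 2 = ‖z - z'‖ ^ 2 - 2 * (t * inner ℝ (G z - G z') (z - z'))
        + t ^ 2 * ‖G z - G z'‖ ^ 2 := by
      rw [h1, norm_sub_sq_real, inner_smul_right, real_inner_comm, norm_smul, mul_pow,
        Real.norm_eq_abs, sq_abs]
    have h3 := hmono z hz z' hz'
    have h4 : ‖G z - G z'‖ ≤ C * ‖z - z'‖ :=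
      (hlip z hz z' hz').trans (mul_le_mul_of_nonneg_right hCK (norm_nonneg _))
    have h5 : ‖G z - G z'‖ ^ 2 ≤ C ^ 2 * ‖z - z'‖ ^ 2 := by
      rw [← mul_pow]; exact pow_le_pow_left₀ (norm_nonneg _) h4 2
    have h6 : t ^ 2 * ‖G z - G z'‖ ^ 2 ≤ e * ‖z - z'‖ ^ 2 := by
      rw [← htC, mul_assoc]; gcongr
    have h7 : e * ‖z - z'‖ ^ 2 ≤ t * inner ℝ (G z - G z') (z - z') := by
      rw [← htc, mul_assoc]; gcongr
    have h8 : ‖T z - T z'‖ ^ 2 ≤ (q * ‖z - z'‖) ^ 2 := by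
      rw [h2, mul_pow, hq]
      nlinarith [mul_nonneg (sq_nonneg e) (sq_nonneg ‖z - z'‖)]
    exact le_of_sq_le_sq h8 (by positivity)
  have hmaps : MapsTo T (Metric.closedBall z₀ ρ) (Metric.closedBall z₀ ρ) := by
    intro z hz
    rw [mem_closedBall_iff_norm]
    have h1 : T z - z₀ = (T z - T z₀) + (-(t • (G z₀ - p))) := by
      simp only [hT]; abel
    rw [h1]
    have h2 := hcontr z hz z₀ hz₀
    have h3 : ‖z - z₀‖ ≤ ρ := mem_closedBall_iff_norm.1 hz
    calc _ ≤ ‖T z - T z₀‖ + ‖-(t • (G z₀ - p))‖ := norm_add_le _ _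
      _ ≤ q * ρ + t * (c * ρ / 2) := by
        rw [norm_neg, norm_smul, Real.norm_of_nonneg ht0.le]
        gcongr
        exact h2.trans (by gcongr)
      _ = ρ := by rw [hq, ← htc]; ring
  have hqcoe : (q.toNNReal : ℝ) = q := Real.coe_toNNReal q hq0.le
  have hTc : ContractingWith q.toNNReal (hmaps.restrict T _ _) := by
    refine ⟨?_, LipschitzWith.of_dist_le_mul fun z z' => ?_⟩
    · rw [← NNReal.coe_lt_coe, hqcoe, NNReal.coe_one, hq]
      linarith
    · rw [hqcoe]
      simpa [Subtype.dist_eq, dist_eq_norm] using hcontr z z.2 z' z'.2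
  obtain ⟨z, hz, hfix, -⟩ := hTc.exists_fixedPoint' Metric.isClosed_closedBall.isComplete hmaps hz₀
    (edist_ne_top _ _)
  refine ⟨z, hz, ?_⟩
  have h1 : t • (G z - p) = 0 := sub_eq_self.1 hfix
  rcases smul_eq_zero.1 h1 with h | h
  · exact absurd h ht0.ne'
  · exact sub_eq_zero.1 h

/-! ### The direction field `w ↦ w/‖w‖` -/

/-- The angular distance of two vectors is controlled by their distance. -/
theorem norm_mul_norm_inv_smul_sub_le {E : Type*} [NormedAddCommGroup E] [NormedSpace ℝ E]
    (w w' : E) : ‖w'‖ * ‖‖w‖⁻¹ • w - ‖w'‖⁻¹ • w'‖ ≤ 2 * ‖w - w'‖ := by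
  rcases eq_or_ne w' 0 with rfl | h'
  · simp
  have hn' : ‖w'‖ ≠ 0 := norm_ne_zero_iff.2 h'
  rcases eq_or_ne w 0 with rfl | h
  · simp only [norm_zero, inv_zero, smul_zero, zero_sub, norm_neg, norm_smul, norm_inv, norm_norm]
    rw [inv_mul_cancel₀ hn']
    linarith [norm_nonneg w']
  have hn : ‖w‖ ≠ 0 := norm_ne_zero_iff.2 h
  have h1 : ‖w'‖ • (‖w‖⁻¹ • w - ‖w'‖⁻¹ • w') = (‖w'‖ - ‖w‖) • (‖w‖⁻¹ • w) + (w - w') := by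
    rw [smul_sub, sub_smul, smul_smul ‖w'‖ ‖w'‖⁻¹, mul_inv_cancel₀ hn', smul_smul ‖w‖,
      mul_inv_cancel₀ hn]
    simp
  have h2 : ‖‖w‖⁻¹ • w‖ = 1 := by
    rw [norm_smul, norm_inv, norm_norm, inv_mul_cancel₀ hn]
  calc _ = ‖‖w'‖ • (‖w‖⁻¹ • w - ‖w'‖⁻¹ • w')‖ := by rw [norm_smul, norm_norm]
    _ ≤ ‖(‖w'‖ - ‖w‖) • (‖w‖⁻¹ • w)‖ + ‖w - w'‖ := by rw [h1]; exact norm_add_le _ _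
    _ = |‖w'‖ - ‖w‖| + ‖w - w'‖ := by rw [norm_smul, h2, mul_one, Real.norm_eq_abs]
    _ ≤ ‖w - w'‖ + ‖w - w'‖ := by
      gcongr
      rw [norm_sub_rev]
      exact abs_norm_sub_norm_le _ _
    _ = _ := by ring

/-- Multiplying the direction field by a scalar function that vanishes at zero tension gives a
Lipschitz vector field. -/
theorem norm_smul_direction_sub_le {E : Type*} [NormedAddCommGroup E] [NormedSpace ℝ E]
    {f : ℝ → ℝ} {L : ℝ} (hf : ∀ r r', |f r - f r'| ≤ L * |r - r'|) (hf0 : f 0 = 0) (w w' : E) :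
    ‖f ‖w‖ • (‖w‖⁻¹ • w) - f ‖w'‖ • (‖w'‖⁻¹ • w')‖ ≤ 3 * L * ‖w - w'‖ := by
  have hL : 0 ≤ L := by simpa using (abs_nonneg _).trans (hf 1 0)
  have h1 : f ‖w‖ • (‖w‖⁻¹ • w) - f ‖w'‖ • (‖w'‖⁻¹ • w')
      = (f ‖w‖ - f ‖w'‖) • (‖w‖⁻¹ • w) + f ‖w'‖ • (‖w‖⁻¹ • w - ‖w'‖⁻¹ • w') := by
    rw [sub_smul, smul_sub]; abel
  have h2 : ‖‖w‖⁻¹ • w‖ ≤ 1 := by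
    rw [norm_smul, norm_inv, norm_norm]; exact inv_mul_le_one
  have h3 : |f ‖w'‖| ≤ L * ‖w'‖ := by simpa [hf0] using hf ‖w'‖ 0
  have h4 : |f ‖w‖ - f ‖w'‖| ≤ L * ‖w - w'‖ :=
    (hf _ _).trans (by gcongr; exact abs_norm_sub_norm_le _ _)
  rw [h1]
  calc _ ≤ |f ‖w‖ - f ‖w'‖| * ‖‖w‖⁻¹ • w‖ + |f ‖w'‖| * ‖‖w‖⁻¹ • w - ‖w'‖⁻¹ • w'‖ := by
        refine (norm_add_le _ _).trans_eq ?_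
        rw [norm_smul, norm_smul (f ‖w'‖), Real.norm_eq_abs, Real.norm_eq_abs]
    _ ≤ (L * ‖w - w'‖) * 1 + (L * ‖w'‖) * ‖‖w‖⁻¹ • w - ‖w'‖⁻¹ • w'‖ := by gcongr
    _ = L * ‖w - w'‖ + L * (‖w'‖ * ‖‖w‖⁻¹ • w - ‖w'‖⁻¹ • w'‖) := by ring
    _ ≤ L * ‖w - w'‖ + L * (2 * ‖w - w'‖) :=
      add_le_add le_rfl (mul_le_mul_of_nonneg_left (norm_mul_norm_inv_smul_sub_le w w') hL)
    _ = _ := by ring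

/-- Quantitative monotonicity of the direction field of the plane. -/
theorem cross_sq_le_inner_direction {w w' : ℂ} {M : ℝ} (h : w ≠ 0) (h' : w' ≠ 0)
    (hM : ‖w‖ ≤ M) (hM' : ‖w'‖ ≤ M) :
    (w'.re * w.im - w.re * w'.im) ^ 2 / M ^ 3
      ≤ inner ℝ (‖w‖⁻¹ • w - ‖w'‖⁻¹ • w') (w - w') := by
  have hr : 0 < ‖w‖ := norm_pos_iff.2 h
  have hr' : 0 < ‖w'‖ := norm_pos_iff.2 h'
  have hMpos : 0 < M := hr.trans_le hM
  set r := ‖w‖ with hrdef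
  set r' := ‖w'‖ with hrdef'
  set d : ℝ := inner ℝ w w' with hd
  have h1 : inner ℝ (r⁻¹ • w - r'⁻¹ • w') (w - w') = (r + r') * (r * r' - d) / (r * r') := by
    rw [inner_sub_left, inner_sub_right, inner_sub_right, real_inner_smul_left,
      real_inner_smul_left, real_inner_smul_left, real_inner_smul_left, real_inner_self_eq_norm_sq,
      real_inner_self_eq_norm_sq, real_inner_comm w w', ← hd, ← hrdef, ← hrdef']
    field_simp
    ring
  have hdle : d ≤ r * r' := real_inner_le_norm w w'
  have hdle' : -(r * r') ≤ d := neg_le_of_abs_le (abs_real_inner_le_norm w w')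
  -- Lagrange's identity: squared cross product plus squared inner product equals `r²r'²`.
  have h2 : (w'.re * w.im - w.re * w'.im) ^ 2 = (r * r' - d) * (r * r' + d) := by
    have e1 : r ^ 2 = w.re ^ 2 + w.im ^ 2 := by
      rw [hrdef, Complex.sq_norm, Complex.normSq_apply]; ring
    have e2 : r' ^ 2 = w'.re ^ 2 + w'.im ^ 2 := by
      rw [hrdef', Complex.sq_norm, Complex.normSq_apply]; ring
    have e3 : d = w.re * w'.re + w.im * w'.im := by
      rw [hd, Complex.inner]; simp; ring
    have : (r * r' - d) * (r * r' + d) = r ^ 2 * r' ^ 2 - d ^ 2 := by ring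
    rw [this, e1, e2, e3]; ring
  rw [h1, h2, div_le_div_iff₀ (by positivity) (by positivity)]
  have h3 : 0 ≤ r * r' - d := by linarith
  have h4 : (r * r' + d) * (r * r') ≤ (r + r') * M ^ 3 := by
    have : r * r' ≤ M * r' := by gcongr
    have h5 : r * r' * r ≤ M * M * M := by gcongr
    have h6 : r * r' * r' ≤ M * M * M := by gcongr
    calc (r * r' + d) * (r * r') ≤ (2 * (r * r')) * (r * r') := by gcongr; linarith
      _ = r' * (r * r' * r) + r * (r * r' * r') := by ring
      _ ≤ r' * (M * M * M) + r * (M * M * M) := by gcongr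
      _ = _ := by ring
  calc (r * r' - d) * (r * r' + d) * (r * r') = (r * r' - d) * ((r * r' + d) * (r * r')) := by ring
    _ ≤ (r * r' - d) * ((r + r') * M ^ 3) := by gcongr
    _ = _ := by ring

/-! ### The support map and its dependence on the stretch -/

/-- The contact force of a compressive state, up to the factor `-γ`, written as a complex number:
`z` is its value at the material point `0`. -/
noncomputable def scaledForce (g : ℝ) (z : ℂ) (s : ℝ) : ℂ := z - ((g * s : ℝ) : ℂ) * Complex.I

/-- The position of the second support in the compressive state with scaled force parameter `z`. -/
noncomputable def supportMap (ν : ℝ → ℝ) (g γ : ℝ) (z : ℂ) : ℂ :=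
  ∫ s in (0 : ℝ)..1,
    ν (-(γ * ‖scaledForce g z s‖)) • (‖scaledForce g z s‖⁻¹ • scaledForce g z s)

@[simp] theorem scaledForce_re (g : ℝ) (z : ℂ) (s : ℝ) : (scaledForce g z s).re = z.re := by
  simp [scaledForce]

@[simp] theorem scaledForce_im (g : ℝ) (z : ℂ) (s : ℝ) :
    (scaledForce g z s).im = z.im - g * s := by
  simp [scaledForce]

theorem scaledForce_ne_zero (g : ℝ) {z : ℂ} (hz : 0 < z.re) (s : ℝ) : scaledForce g z s ≠ 0 := by
  intro h
  have := congrArg Complex.re h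
  simp only [scaledForce_re, Complex.zero_re] at this
  exact hz.ne' this

theorem scaledForce_sub (g : ℝ) (z z' : ℂ) (s : ℝ) :
    scaledForce g z s - scaledForce g z' s = z - z' := by
  simp [scaledForce]

theorem norm_scaledForce_sub_le {g : ℝ} (hg : 0 < g) (z : ℂ) {s : ℝ} (hs : s ∈ Icc (0 : ℝ) 1) :
    ‖scaledForce g z s - z‖ ≤ g := by
  have : scaledForce g z s - z = -(((g * s : ℝ) : ℂ) * Complex.I) := by simp [scaledForce]
  rw [this, norm_neg, norm_mul, Complex.norm_I, mul_one, Complex.norm_real, Real.norm_eq_abs,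
    abs_of_nonneg (mul_nonneg hg.le hs.1)]
  nlinarith [hs.2]

theorem norm_scaledForce_le {g : ℝ} (hg : 0 < g) (z : ℂ) {s : ℝ} (hs : s ∈ Icc (0 : ℝ) 1) :
    ‖scaledForce g z s‖ ≤ ‖z‖ + g := by
  have h := norm_scaledForce_sub_le hg z hs
  calc ‖scaledForce g z s‖ = ‖z + (scaledForce g z s - z)‖ := by congr 1; ring
    _ ≤ ‖z‖ + g := (norm_add_le _ _).trans (by gcongr)

theorem continuous_scaledForce (g : ℝ) (z : ℂ) : Continuous (scaledForce g z) := by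
  unfold scaledForce; fun_prop

theorem continuous_direction (g : ℝ) {z : ℂ} (hz : 0 < z.re) :
    Continuous fun s => ‖scaledForce g z s‖⁻¹ • scaledForce g z s := by
  have h := continuous_scaledForce g z
  exact (h.norm.inv₀ fun s => norm_ne_zero_iff.2 (scaledForce_ne_zero g hz s)).smul h

theorem continuous_supportMap_integrand {ν : ℝ → ℝ} (hν : Continuous ν) (g γ : ℝ) {z : ℂ}
    (hz : 0 < z.re) : Continuous fun s =>
      ν (-(γ * ‖scaledForce g z s‖)) • (‖scaledForce g z s‖⁻¹ • scaledForce g z s) := by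
  have h := continuous_scaledForce g z
  exact (hν.comp (h.norm.const_mul γ).neg).smul (continuous_direction g hz)

theorem intervalIntegral_inner {f : ℝ → ℂ} (hf : Continuous f) (v : ℂ) :
    inner ℝ (∫ s in (0 : ℝ)..1, f s) v = ∫ s in (0 : ℝ)..1, inner ℝ (f s) v := by
  have h := (innerSL ℝ v).intervalIntegral_comp_comm (hf.intervalIntegrable (μ := MeasureTheory.volume) 0 1)
  simp only [innerSL_apply_apply] at h
  rw [real_inner_comm, ← h]
  simp only [real_inner_comm]

theorem norm_direction {E : Type*} [NormedAddCommGroup E] [NormedSpace ℝ E] {w : E} (hw : w ≠ 0) :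
    ‖‖w‖⁻¹ • w‖ = 1 := by
  rw [norm_smul, norm_inv, norm_norm, inv_mul_cancel₀ (norm_ne_zero_iff.2 hw)]

theorem supportMap_one_sub (g γ : ℝ) {z z' : ℂ} (hz : 0 < z.re) (hz' : 0 < z'.re) :
    supportMap (fun _ => 1) g γ z - supportMap (fun _ => 1) g γ z' =
      ∫ s in (0 : ℝ)..1, (‖scaledForce g z s‖⁻¹ • scaledForce g z s
        - ‖scaledForce g z' s‖⁻¹ • scaledForce g z' s) := by
  unfold supportMap
  simp only [one_smul]
  exact (intervalIntegral.integral_sub ((continuous_direction g hz).intervalIntegrable 0 1)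
    ((continuous_direction g hz').intervalIntegrable 0 1)).symm

theorem supportMap_sub_one {ν : ℝ → ℝ} (hν : Continuous ν) (g γ γ' : ℝ) {z : ℂ} (hz : 0 < z.re) :
    supportMap ν g γ z - supportMap (fun _ => 1) g γ' z =
      ∫ s in (0 : ℝ)..1, (ν (-(γ * ‖scaledForce g z s‖)) - 1) •
        (‖scaledForce g z s‖⁻¹ • scaledForce g z s) := by
  unfold supportMap
  rw [← intervalIntegral.integral_sub
    ((continuous_supportMap_integrand hν g γ hz).intervalIntegrable 0 1)
    ((continuous_supportMap_integrand continuous_const g γ' hz).intervalIntegrable 0 1)]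
  simp only [sub_smul]

theorem norm_intervalIntegral_le {f : ℝ → ℂ} {C : ℝ} (h : ∀ s ∈ Icc (0 : ℝ) 1, ‖f s‖ ≤ C) :
    ‖∫ s in (0 : ℝ)..1, f s‖ ≤ C := by
  have := intervalIntegral.norm_integral_le_of_norm_le_const (a := (0 : ℝ)) (b := 1) (f := f)
    (C := C) fun s hs => h s (Ioc_subset_Icc_self (by rwa [uIoc_of_le zero_le_one] at hs))
  simpa using this

theorem norm_supportMap_one_sub_le (g γ : ℝ) {z z' : ℂ} {r : ℝ} (hr : 0 < r) (hz : 0 < z.re)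
    (hz' : r ≤ z'.re) :
    ‖supportMap (fun _ => 1) g γ z - supportMap (fun _ => 1) g γ z'‖ ≤ 2 / r * ‖z - z'‖ := by
  rw [supportMap_one_sub g γ hz (hr.trans_le hz')]
  refine norm_intervalIntegral_le fun s _ => ?_
  have h1 := norm_mul_norm_inv_smul_sub_le (scaledForce g z s) (scaledForce g z' s)
  rw [scaledForce_sub] at h1
  have h2 : r ≤ ‖scaledForce g z' s‖ :=
    hz'.trans (by simpa using Complex.re_le_norm (scaledForce g z' s))
  rw [div_mul_eq_mul_div, le_div_iff₀ hr, mul_comm]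
  exact (mul_le_mul_of_nonneg_right h2 (norm_nonneg _)).trans h1

theorem norm_supportMap_sub_one_le {ν : ℝ → ℝ} {L : ℝ} (hL : 0 ≤ L) (hν : Continuous ν)
    (hlip : ∀ r r', |ν r - ν r'| ≤ L * |r - r'|) (hν0 : ν 0 = 1) {g γ : ℝ} (hg : 0 < g)
    (hγ : 0 ≤ γ) (γ' : ℝ) {z : ℂ} (hz : 0 < z.re) :
    ‖supportMap ν g γ z - supportMap (fun _ => 1) g γ' z‖ ≤ L * γ * (‖z‖ + g) := by
  rw [supportMap_sub_one hν g γ γ' hz]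
  refine norm_intervalIntegral_le fun s hs => ?_
  rw [norm_smul, norm_direction (scaledForce_ne_zero g hz s), mul_one, Real.norm_eq_abs]
  have h := hlip (-(γ * ‖scaledForce g z s‖)) 0
  rw [hν0, sub_zero, abs_neg, abs_of_nonneg (a := γ * _) (by positivity), ← mul_assoc] at h
  refine h.trans ?_
  gcongr
  exact norm_scaledForce_le hg z hs

/-- The direction field alone is not Lipschitz near `w = 0`, but the factor `ν(-γ‖w‖) - 1` vanishes
there. The constant is therefore independent of the distance of `z`, `z'` from the imaginary axis.
-/
theorem norm_supportMap_sub_one_sub_le {ν : ℝ → ℝ} {L : ℝ} (hν : Continuous ν)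
    (hlip : ∀ r r', |ν r - ν r'| ≤ L * |r - r'|) (hν0 : ν 0 = 1) {g γ : ℝ}
    (hγ : 0 ≤ γ) (γ' : ℝ) {z z' : ℂ} (hz : 0 < z.re) (hz' : 0 < z'.re) :
    ‖(supportMap ν g γ z - supportMap (fun _ => 1) g γ' z)
      - (supportMap ν g γ z' - supportMap (fun _ => 1) g γ' z')‖ ≤ 3 * (L * γ) * ‖z - z'‖ := by
  have hcont : ∀ {z : ℂ}, 0 < z.re → Continuous fun s =>
      (ν (-(γ * ‖scaledForce g z s‖)) - 1) • (‖scaledForce g z s‖⁻¹ • scaledForce g z s) :=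
    fun h => continuous_supportMap_integrand (ν := fun r => ν r - 1) (hν.sub continuous_const) g γ h
  rw [supportMap_sub_one hν g γ γ' hz, supportMap_sub_one hν g γ γ' hz',
    ← intervalIntegral.integral_sub ((hcont hz).intervalIntegrable 0 1)
      ((hcont hz').intervalIntegrable 0 1)]
  refine norm_intervalIntegral_le fun s _ => ?_
  rw [← scaledForce_sub g z z' s]
  refine norm_smul_direction_sub_le (f := fun r => ν (-(γ * r)) - 1) (fun r r' => ?_) (by simp [hν0])
    _ _
  have h := hlip (-(γ * r)) (-(γ * r'))
  have e : |-(γ * r) - -(γ * r')| = γ * |r - r'| := by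
    rw [← abs_of_nonneg hγ, ← abs_mul, abs_of_nonneg hγ, abs_sub_comm]; congr 1; ring
  rw [e, ← mul_assoc] at h
  simpa using h

/-! ### Strong monotonicity of the inextensible support map -/

/-- The quadratic form on the right is `∫₀¹ (A + gsB)² ds`, hence definite; bounding `A²` and `B²`
separately by completing squares gives `8` and `48/g²`. -/
theorem sq_add_sq_le_moment {g : ℝ} (hg : 0 < g) (A B : ℝ) :
    A ^ 2 + B ^ 2 ≤ (8 + 48 / g ^ 2) * (A ^ 2 + A * (g * B) + (g * B) ^ 2 / 3) := by
  have h1 : A ^ 2 / 8 ≤ A ^ 2 + A * (g * B) + (g * B) ^ 2 / 3 := by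
    nlinarith [sq_nonneg (7 * A + 4 * (g * B)), sq_nonneg (g * B)]
  have h2 : (g * B) ^ 2 / 48 ≤ A ^ 2 + A * (g * B) + (g * B) ^ 2 / 3 := by
    nlinarith [sq_nonneg (2 * A + g * B), sq_nonneg (g * B)]
  have h3 : 48 / g ^ 2 * ((g * B) ^ 2 / 48) = B ^ 2 := by field_simp
  have h4 := mul_le_mul_of_nonneg_left h2 (by positivity : 0 ≤ 48 / g ^ 2)
  rw [add_mul]
  linarith

/-- Recovers the vertical difference `D` from the cross product `A` and the horizontal difference
`B`. Only one of the two points, with coordinates `(x, y)`, needs a positive lower bound on its real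
part. -/
theorem sq_add_sq_le_of_cross {r R x y A B D : ℝ} (hr : 0 < r) (hx : r ≤ x) (hy : |y| ≤ R)
    (h : x * D = A + y * B) :
    B ^ 2 + D ^ 2 ≤ 2 * ((1 + R) ^ 2 / r ^ 2 + 1) * (A ^ 2 + B ^ 2) := by
  have hR : 0 ≤ R := (abs_nonneg _).trans hy
  have h2 : y ^ 2 ≤ R ^ 2 := by
    rw [← sq_abs]
    exact pow_le_pow_left₀ (abs_nonneg _) hy 2
  have h3 : r ^ 2 * D ^ 2 ≤ 2 * ((1 + R) ^ 2 * (A ^ 2 + B ^ 2)) := by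
    have h5 : 0 ≤ (2 * R + R ^ 2) * A ^ 2 + (1 + 2 * R) * B ^ 2 := by positivity
    calc r ^ 2 * D ^ 2 ≤ x ^ 2 * D ^ 2 := by gcongr
      _ = (A + y * B) ^ 2 := by rw [← mul_pow, h]
      _ ≤ 2 * (A ^ 2 + y ^ 2 * B ^ 2) := by linarith [sq_nonneg (A - y * B)]
      _ ≤ 2 * (A ^ 2 + R ^ 2 * B ^ 2) := by gcongr
      _ ≤ 2 * ((1 + R) ^ 2 * (A ^ 2 + B ^ 2)) := by linarith
  have h4 : D ^ 2 ≤ 2 * ((1 + R) ^ 2 / r ^ 2) * (A ^ 2 + B ^ 2) := by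
    have e : 2 * ((1 + R) ^ 2 / r ^ 2) * (A ^ 2 + B ^ 2)
        = 2 * ((1 + R) ^ 2 * (A ^ 2 + B ^ 2)) / r ^ 2 := by ring
    rw [e, le_div_iff₀ (by positivity)]
    linarith
  linarith [sq_nonneg A, sq_nonneg B]

/-- Strong monotonicity of the support map of the inextensible string. -/
theorem exists_stronglyMonotone_supportMap_one {g r R : ℝ} (hg : 0 < g) (hr : 0 < r) :
    ∃ c : ℝ, 0 < c ∧ ∀ γ : ℝ, ∀ z z' : ℂ, 0 < z.re → r ≤ z'.re → ‖z‖ ≤ R → ‖z'‖ ≤ R →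
      c * ‖z - z'‖ ^ 2 ≤
        inner ℝ (supportMap (fun _ => 1) g γ z - supportMap (fun _ => 1) g γ z') (z - z') := by
  rcases le_or_gt R 0 with hR | hR
  · refine ⟨1, one_pos, fun γ z z' hz _ hzR _ => ?_⟩
    have := (hz.trans_le (Complex.re_le_norm z)).trans_le (hzR.trans hR)
    exact absurd this (lt_irrefl _)
  set M : ℝ := R + g with hM
  have hMpos : 0 < M := by positivity
  set k : ℝ := 2 * ((1 + R) ^ 2 / r ^ 2 + 1) with hk
  set q : ℝ := 8 + 48 / g ^ 2 with hq
  refine ⟨(k * q * M ^ 3)⁻¹, by positivity, fun γ z z' hz hz' hzR hzR' => ?_⟩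
  have hz'0 : 0 < z'.re := hr.trans_le hz'
  set B : ℝ := z.re - z'.re with hB
  set D : ℝ := z.im - z'.im with hD
  set A : ℝ := z'.re * z.im - z.re * z'.im with hA
  -- The cross product is affine in `s`, so its square cannot integrate to zero unless `A = B = 0`,
  -- that is, `z = z'`.
  have hcross : ∀ s, (scaledForce g z' s).re * (scaledForce g z s).im
      - (scaledForce g z s).re * (scaledForce g z' s).im = A + g * s * B := by
    intro s; simp only [scaledForce_re, scaledForce_im, hA, hB]; ring
  have hint : ∫ s in (0 : ℝ)..1, (A + g * s * B) ^ 2 / M ^ 3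
      = (A ^ 2 + A * (g * B) + (g * B) ^ 2 / 3) / M ^ 3 := by
    rw [intervalIntegral.integral_div]
    congr 1
    have hder : ∀ s ∈ uIcc (0 : ℝ) 1, HasDerivAt
        (fun s : ℝ => A ^ 2 * s + A * (g * B) * s ^ 2 + (g * B) ^ 2 / 3 * s ^ 3)
        ((A + g * s * B) ^ 2) s := by
      intro s _
      have := (((hasDerivAt_id s).const_mul (A ^ 2)).add
        ((hasDerivAt_pow 2 s).const_mul (A * (g * B)))).add
        ((hasDerivAt_pow 3 s).const_mul ((g * B) ^ 2 / 3))
      refine this.congr_deriv ?_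
      norm_num
      ring
    rw [intervalIntegral.integral_eq_sub_of_hasDerivAt hder
      (Continuous.intervalIntegrable (by fun_prop) 0 1)]
    ring
  have hdir : Continuous fun s => ‖scaledForce g z s‖⁻¹ • scaledForce g z s
        - ‖scaledForce g z' s‖⁻¹ • scaledForce g z' s :=
    (continuous_direction g hz).sub (continuous_direction g hz'0)
  rw [supportMap_one_sub g γ hz hz'0, intervalIntegral_inner hdir]
  have hle : ∫ s in (0 : ℝ)..1, (A + g * s * B) ^ 2 / M ^ 3 ≤ ∫ s in (0 : ℝ)..1,
      inner ℝ (‖scaledForce g z s‖⁻¹ • scaledForce g z s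
        - ‖scaledForce g z' s‖⁻¹ • scaledForce g z' s) (z - z') := by
    refine intervalIntegral.integral_mono_on zero_le_one
      (Continuous.intervalIntegrable (by fun_prop) 0 1)
      ((hdir.inner continuous_const).intervalIntegrable 0 1) fun s hs => ?_
    rw [← hcross s, ← scaledForce_sub g z z' s]
    exact cross_sq_le_inner_direction (scaledForce_ne_zero g hz s) (scaledForce_ne_zero g hz'0 s)
      ((norm_scaledForce_le hg z hs).trans (by rw [hM]; gcongr))
      ((norm_scaledForce_le hg z' hs).trans (by rw [hM]; gcongr))
  refine le_trans ?_ hle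
  rw [hint, mul_inv, ← div_eq_mul_inv, div_mul_eq_mul_div]
  refine div_le_div_of_nonneg_right ?_ (by positivity)
  rw [inv_mul_le_iff₀ (by positivity)]
  have hDle : B ^ 2 + D ^ 2 ≤ k * (A ^ 2 + B ^ 2) :=
    sq_add_sq_le_of_cross (x := z'.re) (y := z'.im) hr hz' ((Complex.abs_im_le_norm z').trans hzR')
      (by rw [hA, hB, hD]; ring)
  have hnorm : ‖z - z'‖ ^ 2 = B ^ 2 + D ^ 2 := by
    rw [Complex.sq_norm, Complex.normSq_apply, Complex.sub_re, Complex.sub_im, hB, hD]; ring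
  rw [hnorm, mul_assoc]
  exact hDle.trans (mul_le_mul_of_nonneg_left (sq_add_sq_le_moment hg A B) (by positivity))

/-! ### A priori bound -/

/-- A priori bound for the scaled force of a compressive state whose stretch is at least `ν₀`. -/
theorem norm_le_of_supportMap_eq {ν : ℝ → ℝ} {ν₀ : ℝ} (hν : Continuous ν) (hν₀ : ∀ r, ν₀ ≤ ν r)
    {g γ : ℝ} (hg : 0 < g) {z p : ℂ} (hz : 0 < z.re) (hp : ‖p‖ < ν₀)
    (h : supportMap ν g γ z = p) : ‖z‖ ≤ g * (ν₀ + ‖p‖) / (ν₀ - ‖p‖) := by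
  have hν₀pos : 0 < ν₀ := (norm_nonneg _).trans_lt hp
  have hd : 0 < ν₀ - ‖p‖ := sub_pos.2 hp
  rw [le_div_iff₀ hd]
  have hn : 0 < ‖z‖ := hz.trans_le (Complex.re_le_norm z)
  rcases le_or_gt ‖z‖ g with hzg | hzg
  · nlinarith [norm_nonneg p]
  have h1 : inner ℝ p z ≤ ‖p‖ * ‖z‖ := real_inner_le_norm p z
  have hden : 0 < ‖z‖ + g := by positivity
  -- Tested with `z`, every direction contributes almost `‖z‖` when `‖z‖` is large, since `w_s`
  -- differs from `z` by at most `g`.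
  have h2 : ν₀ * (‖z‖ * (‖z‖ - g) / (‖z‖ + g)) ≤ inner ℝ p z := by
    rw [← h, supportMap, intervalIntegral_inner (continuous_supportMap_integrand hν g γ hz)]
    have hc : ∫ _ in (0 : ℝ)..1, ν₀ * (‖z‖ * (‖z‖ - g) / (‖z‖ + g))
        = ν₀ * (‖z‖ * (‖z‖ - g) / (‖z‖ + g)) := by simp
    rw [← hc]
    refine intervalIntegral.integral_mono_on zero_le_one (by simp)
      (((continuous_supportMap_integrand hν g γ hz).inner continuous_const).intervalIntegrable 0 1)
      fun s hs => ?_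
    have hw := norm_pos_iff.2 (scaledForce_ne_zero g hz s)
    have h3 : ‖z‖ * (‖z‖ - g) ≤ inner ℝ (scaledForce g z s) z := by
      have e : scaledForce g z s = z + (scaledForce g z s - z) := by ring
      rw [e, inner_add_left, real_inner_self_eq_norm_sq]
      have := neg_le_of_abs_le (abs_real_inner_le_norm (scaledForce g z s - z) z)
      have := mul_le_mul_of_nonneg_right (norm_scaledForce_sub_le hg z hs) hn.le
      nlinarith
    rw [real_inner_smul_left, real_inner_smul_left]
    have h4 : 0 ≤ ‖z‖ * (‖z‖ - g) := mul_nonneg hn.le (by linarith)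
    have h5 : ‖z‖ * (‖z‖ - g) / (‖z‖ + g) ≤
        ‖scaledForce g z s‖⁻¹ * inner ℝ (scaledForce g z s) z := by
      rw [inv_mul_eq_div]
      exact div_le_div₀ (h4.trans h3) h3 hw (norm_scaledForce_le hg z hs)
    exact mul_le_mul (hν₀ _) h5 (div_nonneg h4 hden.le) (hν₀pos.le.trans (hν₀ _))
  have h6 := h2.trans h1
  rw [← mul_div_assoc, div_le_iff₀ hden] at h6
  have h7 : ν₀ * (‖z‖ - g) ≤ ‖p‖ * (‖z‖ + g) := by
    by_contra! hcon
    nlinarith [mul_lt_mul_of_pos_left hcon hn]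
  linarith

/-! ### Translation to the original unknowns -/

theorem contactMagnitude_eq {g γ : ℝ} (hγ : 0 ≤ γ) (z : ℂ) (s : ℝ) :
    contactMagnitude g γ (-(γ * z.re)) (-(γ * z.im)) s = γ * ‖scaledForce g z s‖ := by
  rw [contactMagnitude]
  have e : (-(γ * z.re)) ^ 2 + (-(γ * z.im) + g * γ * s) ^ 2 = (γ * ‖scaledForce g z s‖) ^ 2 := by
    rw [mul_pow, Complex.sq_norm, Complex.normSq_apply, scaledForce_re, scaledForce_im]; ring
  rw [e, Real.sqrt_sq (by positivity)]

/-- The compressive equilibrium equations in terms of the scaled force parameter. -/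
theorem solvesCompressive_iff_supportMap {ν : ℝ → ℝ} (hν : Continuous ν) {g γ a b : ℝ}
    (hγ : 0 < γ) {z : ℂ} (hz : 0 < z.re) :
    SolvesCompressive ν g γ a b (-(γ * z.re)) (-(γ * z.im)) ↔ supportMap ν g γ z = ⟨a, b⟩ := by
  have hδ := contactMagnitude_eq (g := g) hγ.le z
  have hint := (continuous_supportMap_integrand hν g γ hz).intervalIntegrable
    (μ := MeasureTheory.volume) 0 1
  have hre := Complex.reCLM.intervalIntegral_comp_comm hint
  have him := Complex.imCLM.intervalIntegral_comp_comm hint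
  simp only [Complex.reCLM_apply, Complex.imCLM_apply, Complex.smul_re, Complex.smul_im,
    scaledForce_re, scaledForce_im, smul_eq_mul] at hre him
  have h1 : ∀ s, compressiveStretch ν g γ (-(γ * z.re)) (-(γ * z.im)) s
      / (-contactMagnitude g γ (-(γ * z.re)) (-(γ * z.im)) s) * (-(γ * z.re))
      = ν (-(γ * ‖scaledForce g z s‖)) * (‖scaledForce g z s‖⁻¹ * z.re) := by
    intro s
    have hw := norm_ne_zero_iff.2 (scaledForce_ne_zero g hz s)
    rw [compressiveStretch, hδ]
    field_simp
  have h2 : ∀ s, compressiveStretch ν g γ (-(γ * z.re)) (-(γ * z.im)) s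
      / (-contactMagnitude g γ (-(γ * z.re)) (-(γ * z.im)) s) * (-(γ * z.im) + g * γ * s)
      = ν (-(γ * ‖scaledForce g z s‖)) * (‖scaledForce g z s‖⁻¹ * (z.im - g * s)) := by
    intro s
    have hw := norm_ne_zero_iff.2 (scaledForce_ne_zero g hz s)
    rw [compressiveStretch, hδ]
    field_simp
    ring
  unfold SolvesCompressive
  simp only [h1, h2]
  rw [hre, him, Complex.ext_iff]
  exact and_congr eq_comm eq_comm

/-! ### The explicit inextensible catenary -/

theorem integral_inextensible_re {g lam mu : ℝ} (hg : 0 < g) (hlam : lam < 0) :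
    ∫ s in (0 : ℝ)..1, compressiveStretch (fun _ => 1) g 1 lam mu s
      / (-contactMagnitude g 1 lam mu s) * lam =
      -lam / g * (Real.arsinh ((mu + g) / -lam) - Real.arsinh (mu / -lam)) := by
  have hpos : ∀ s : ℝ, 0 < lam ^ 2 + (mu + g * s) ^ 2 := fun s => by
    have := sq_pos_of_neg hlam; positivity
  have hder : ∀ s ∈ uIcc (0 : ℝ) 1, HasDerivAt
      (fun s : ℝ => -lam / g * Real.arsinh ((mu + g * s) / -lam))
      (compressiveStretch (fun _ => 1) g 1 lam mu s / (-contactMagnitude g 1 lam mu s) * lam) s := by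
    intro s _
    have h1 : HasDerivAt (fun s : ℝ => (mu + g * s) / -lam) (g / -lam) s := by
      simpa using (((hasDerivAt_id s).const_mul g).const_add mu).div_const (-lam)
    refine (h1.arsinh.const_mul (-lam / g)).congr_deriv ?_
    have e : 1 + ((mu + g * s) / -lam) ^ 2 = (lam ^ 2 + (mu + g * s) ^ 2) / (-lam) ^ 2 := by
      have := hlam.ne
      field_simp
    have hs := (Real.sqrt_pos.2 (hpos s)).ne'
    rw [compressiveStretch, contactMagnitude, e, Real.sqrt_div (hpos s).le,
      Real.sqrt_sq (by linarith), mul_one]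
    have := hlam.ne
    simp only [smul_eq_mul]
    field_simp
  rw [intervalIntegral.integral_eq_sub_of_hasDerivAt hder]
  · simp only [mul_one, mul_zero, add_zero]; ring
  · refine Continuous.intervalIntegrable ?_ 0 1
    simp only [compressiveStretch, contactMagnitude, mul_one]
    refine Continuous.mul (Continuous.div continuous_const (by fun_prop) fun s => ?_)
      continuous_const
    exact neg_ne_zero.2 (Real.sqrt_pos.2 (hpos s)).ne'

theorem integral_inextensible_im {g lam mu : ℝ} (hg : 0 < g) (hlam : lam < 0) :
    ∫ s in (0 : ℝ)..1, compressiveStretch (fun _ => 1) g 1 lam mu s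
      / (-contactMagnitude g 1 lam mu s) * (mu + g * 1 * s) =
      -(√(lam ^ 2 + (mu + g) ^ 2) - √(lam ^ 2 + mu ^ 2)) / g := by
  have hpos : ∀ s : ℝ, 0 < lam ^ 2 + (mu + g * s) ^ 2 := fun s => by
    have := sq_pos_of_neg hlam; positivity
  have hder : ∀ s ∈ uIcc (0 : ℝ) 1, HasDerivAt
      (fun s : ℝ => -√(lam ^ 2 + (mu + g * s) ^ 2) / g)
      (compressiveStretch (fun _ => 1) g 1 lam mu s / (-contactMagnitude g 1 lam mu s)
        * (mu + g * 1 * s)) s := by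
    intro s _
    have h1 : HasDerivAt (fun s : ℝ => lam ^ 2 + (mu + g * s) ^ 2) (2 * (mu + g * s) * g) s := by
      simpa using (((((hasDerivAt_id s).const_mul g).const_add mu).pow 2).const_add (lam ^ 2))
    refine ((h1.sqrt (hpos s).ne').neg.div_const g).congr_deriv ?_
    have hs := (Real.sqrt_pos.2 (hpos s)).ne'
    rw [compressiveStretch, contactMagnitude, mul_one]
    field_simp
  rw [intervalIntegral.integral_eq_sub_of_hasDerivAt hder]
  · simp only [mul_one, mul_zero, add_zero]; ring
  · refine Continuous.intervalIntegrable ?_ 0 1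
    simp only [compressiveStretch, contactMagnitude, mul_one]
    refine Continuous.mul (Continuous.div continuous_const (by fun_prop) fun s => ?_)
      (by fun_prop)
    exact neg_ne_zero.2 (Real.sqrt_pos.2 (hpos s)).ne'

/-- Hyperbolic form of the equations of a catenary with unit length: `Λ sinh u` and `Λ sinh v` are
the vertical contact forces at the end points. -/
theorem catenary_hyperbolic_iff {g a b Λ m : ℝ} (hg : 0 < g) (ha : 0 < a) (hb : b ^ 2 < 1)
    (hΛ : 0 < Λ) :
    (a = Λ / g * (Real.arsinh ((m + g) / Λ) - Real.arsinh (m / Λ)) ∧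
      b = -(Λ * Real.cosh (Real.arsinh ((m + g) / Λ)) - Λ * Real.cosh (Real.arsinh (m / Λ))) / g) ↔
    (√(1 - b ^ 2) / a = 2 * Λ / (a * g) * Real.sinh (a * g / (2 * Λ)) ∧
      m = -Λ * Real.sinh (a * g / (2 * Λ) + Real.artanh b)) := by
  set θ : ℝ := a * g / (2 * Λ) with hθ
  have hθpos : 0 < θ := by positivity
  have haθ : a = Λ / g * (2 * θ) := by rw [hθ]; field_simp
  have hsθ : 0 < Real.sinh θ := Real.sinh_pos_iff.2 hθpos
  have hbm : b ∈ Ioo (-1 : ℝ) 1 := by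
    constructor <;> nlinarith
  set β : ℝ := Real.artanh b with hβ
  have htβ : Real.tanh β = b := Real.tanh_artanh hbm
  have hcβ : Real.cosh β * √(1 - b ^ 2) = 1 := by
    have : 0 < √(1 - b ^ 2) := Real.sqrt_pos.2 (by linarith)
    rw [hβ, Real.cosh_artanh hbm, one_div_mul_cancel this.ne']
  have hfirst : √(1 - b ^ 2) / a = 2 * Λ / (a * g) * Real.sinh θ ↔
      g = 2 * Λ * Real.cosh β * Real.sinh θ := by
    have hc := Real.cosh_pos β
    have h1 : √(1 - b ^ 2) = (Real.cosh β)⁻¹ := by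
      rw [eq_comm, inv_eq_iff_eq_inv, eq_comm]
      exact inv_eq_of_mul_eq_one_left hcβ
    rw [h1]
    constructor
    · intro h; field_simp at h; linarith
    · intro h; field_simp; linarith
  rw [hfirst]
  constructor
  · rintro ⟨h1, h2⟩
    set u := Real.arsinh (m / Λ) with hu
    set v := Real.arsinh ((m + g) / Λ) with hv
    have hmu : m = Λ * Real.sinh u := by rw [hu, Real.sinh_arsinh]; field_simp
    have hmv : m + g = Λ * Real.sinh v := by rw [hv, Real.sinh_arsinh]; field_simp
    have hvu : v - u = 2 * θ := by
      have h3 := haθ.symm.trans h1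
      have : Λ / g ≠ 0 := by positivity
      exact (mul_left_cancel₀ this h3).symm
    -- With midpoint `η` and half difference `θ`, the increments of `sinh` and `cosh` are `2 cosh η
    -- sinh θ` and `2 sinh η sinh θ`; their quotient yields `b = -tanh η`.
    set η := (u + v) / 2 with hη
    have hu' : u = η - θ := by rw [hη]; linarith
    have hv' : v = η + θ := by rw [hη]; linarith
    have hgη : g = 2 * Λ * Real.cosh η * Real.sinh θ := by
      have : g = Λ * Real.sinh v - Λ * Real.sinh u := by linarith
      rw [this, hu', hv', Real.sinh_sub, Real.sinh_add]; ring
    have hbη : b = Real.tanh (-η) := by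
      have hc := Real.cosh_pos η
      rw [h2, hu', hv', Real.cosh_sub, Real.cosh_add, Real.tanh_neg, Real.tanh_eq_sinh_div_cosh,
        hgη]
      field_simp
      ring
    have hηβ : β = -η := by rw [hβ, hbη, Real.artanh_tanh]
    refine ⟨by rw [hηβ, Real.cosh_neg]; exact hgη, ?_⟩
    rw [hmu, hu', hηβ, ← sub_eq_add_neg, ← neg_sub θ η, Real.sinh_neg]; ring
  · rintro ⟨h1, h2⟩
    have hu : Real.arsinh (m / Λ) = -(θ + β) := by
      rw [← Real.arsinh_sinh (-(θ + β)), Real.sinh_neg, h2]; congr 1; field_simp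
    have hv : Real.arsinh ((m + g) / Λ) = θ - β := by
      rw [← Real.arsinh_sinh (θ - β)]
      congr 1
      rw [div_eq_iff hΛ.ne', h2, h1, Real.sinh_add, Real.sinh_sub]
      ring
    rw [hu, hv]
    refine ⟨by rw [haθ]; ring, ?_⟩
    have hc := Real.cosh_pos β
    rw [Real.cosh_neg, Real.cosh_sub, Real.cosh_add, ← htβ, Real.tanh_eq_sinh_div_cosh, h1]
    field_simp
    ring

theorem solvesInextensible_iff_explicit {g a b lam mu : ℝ} (hg : 0 < g) (ha : 0 < a)
    (hb : b ^ 2 < 1) (hlam : lam < 0) :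
    SolvesInextensible g 1 a b lam mu ↔ ExplicitInextensible g 1 a b lam mu := by
  unfold SolvesInextensible SolvesCompressive ExplicitInextensible
  rw [integral_inextensible_re hg hlam, integral_inextensible_im hg hlam, abs_of_neg hlam, mul_one]
  have h := catenary_hyperbolic_iff (m := mu) hg ha hb (neg_pos.2 hlam)
  have hcosh : ∀ t : ℝ, -lam * Real.cosh (Real.arsinh (t / -lam)) = √(lam ^ 2 + t ^ 2) := by
    intro t
    have e : lam ^ 2 + t ^ 2 = (-lam) ^ 2 * (1 + (t / -lam) ^ 2) := by
      have := hlam.ne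
      field_simp
    rw [Real.cosh_arsinh, e, Real.sqrt_mul (sq_nonneg _), Real.sqrt_sq (by linarith)]
  rw [hcosh, hcosh, neg_neg] at h
  exact h

/-- `sinh θ - kθ` has slope `1 - k < 0` at `0` and is eventually positive. -/
theorem exists_sinh_eq_mul {k : ℝ} (hk : 1 < k) : ∃ θ : ℝ, 0 < θ ∧ Real.sinh θ = k * θ := by
  have hder : HasDerivAt (fun θ => Real.sinh θ - k * θ) (1 - k) 0 := by
    exact ((Real.hasDerivAt_sinh 0).sub ((hasDerivAt_id (0 : ℝ)).const_mul k)).congr_deriv (by simp)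
  obtain ⟨x, hx0, hx⟩ : ∃ x : ℝ, 0 < x ∧ Real.sinh x - k * x < 0 := by
    have h := (hder.tendsto_slope_zero_right.eventually_lt_const (sub_neg.2 hk)).and
      self_mem_nhdsWithin
    obtain ⟨x, hx, hx0⟩ := h.exists
    have hx0 : 0 < x := hx0
    refine ⟨x, hx0, ?_⟩
    simpa [inv_mul_lt_iff₀ hx0] using hx
  obtain ⟨y, hy0, hy⟩ : ∃ y : ℝ, x < y ∧ 0 < Real.sinh y - k * y := by
    -- For `y ≥ 4k`, the quadratic term of `exp y` already gives `y²/4 ≥ ky` in `sinh y`.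
    refine ⟨x + 4 * k, by linarith, ?_⟩
    have h1 := Real.quadratic_le_exp_of_nonneg (x := x + 4 * k) (by linarith)
    have h2 : Real.exp (-(x + 4 * k)) ≤ 1 := Real.exp_le_one_iff.2 (by linarith)
    rw [Real.sinh_eq]
    nlinarith [mul_pos hx0 (by linarith : 0 < k)]
  obtain ⟨θ, hθ, h⟩ := intermediate_value_Icc hy0.le
    (f := fun θ => Real.sinh θ - k * θ) (by fun_prop) ⟨hx.le, hy.le⟩
  exact ⟨θ, hx0.trans_le hθ.1, sub_eq_zero.1 h⟩

theorem exists_explicitInextensible {g a b : ℝ} (hg : 0 < g) (ha : 0 < a)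
    (hab : a ^ 2 + b ^ 2 < 1) : ∃ lam mu : ℝ, lam < 0 ∧ ExplicitInextensible g 1 a b lam mu := by
  have hk : 1 < √(1 - b ^ 2) / a := by
    rw [lt_div_iff₀ ha, one_mul]
    exact Real.lt_sqrt_of_sq_lt (by linarith)
  obtain ⟨θ, hθ, h⟩ := exists_sinh_eq_mul hk
  have hlam : 0 < a * g / (2 * θ) := by positivity
  refine ⟨-(a * g / (2 * θ)), _, neg_lt_zero.2 hlam, ?_, rfl⟩
  rw [abs_neg, abs_of_pos hlam, mul_one]
  have e1 : a * g / (2 * (a * g / (2 * θ))) = θ := by field_simp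
  rw [e1, h]
  field_simp

/-! ### Consequences of the constitutive law -/

namespace IsStretchLimited

variable {νhat : ℝ → ℝ} {N₀ N₁ ν₀ ν₁ : ℝ}

/-- Clamping the tension to `[N₀, N₁]` turns the estimates on that interval into global ones. -/
theorem eq_max_min (hν : IsStretchLimited νhat N₀ N₁ ν₀ ν₁) (N : ℝ) :
    νhat N = νhat (max N₀ (min N₁ N)) := by
  have h01 : N₀ < N₁ := hν.N₀_neg.trans hν.N₁_pos
  rcases le_total N N₀ with h | h
  · rw [max_eq_left ((min_le_right _ _).trans h), hν.eq_of_le N h, hν.eq_of_le N₀ le_rfl]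
  · rcases le_total N₁ N with h' | h'
    · rw [min_eq_left h', max_eq_right h01.le, hν.eq_of_ge N h', hν.eq_of_ge N₁ le_rfl]
    · rw [min_eq_right h', max_eq_right h]

theorem exists_lipschitz (hν : IsStretchLimited νhat N₀ N₁ ν₀ ν₁) :
    ∃ L : ℝ, 0 ≤ L ∧ ∀ r r', |νhat r - νhat r'| ≤ L * |r - r'| := by
  have h01 : N₀ < N₁ := hν.N₀_neg.trans hν.N₁_pos
  obtain ⟨K, hK⟩ := (hν.contDiffOn.of_le (by simp) : ContDiffOn ℝ 1 νhat _).exists_lipschitzOnWith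
    one_ne_zero (convex_Icc N₀ N₁) isCompact_Icc
  have hmem : ∀ N : ℝ, max N₀ (min N₁ N) ∈ Icc N₀ N₁ := fun N =>
    ⟨le_max_left _ _, max_le h01.le (min_le_left _ _)⟩
  refine ⟨K, K.2, fun r r' => ?_⟩
  rw [hν.eq_max_min r, hν.eq_max_min r']
  have h := hK.dist_le_mul _ (hmem r) _ (hmem r')
  rw [Real.dist_eq, Real.dist_eq] at h
  refine h.trans (mul_le_mul_of_nonneg_left ?_ K.2)
  exact (abs_max_sub_max_le_max _ _ _ _).trans
    (by simpa using abs_min_sub_min_le_max N₁ r N₁ r')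

theorem le_stretch (hν : IsStretchLimited νhat N₀ N₁ ν₀ ν₁) (N : ℝ) : ν₀ ≤ νhat N := by
  have h01 : N₀ < N₁ := hν.N₀_neg.trans hν.N₁_pos
  rw [hν.eq_max_min N]
  exact (hν.mapsTo ⟨le_max_left _ _, max_le h01.le (min_le_left _ _)⟩).1

theorem stretch_mem_Ioo (hν : IsStretchLimited νhat N₀ N₁ ν₀ ν₁) {N : ℝ} (hN : N ∈ Ioo N₀ 0) :
    νhat N ∈ Ioo ν₀ 1 := by
  have h01 : N₀ < N₁ := hν.N₀_neg.trans hν.N₁_pos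
  have hmono : StrictMonoOn νhat (Icc N₀ N₁) := by
    refine strictMonoOn_of_deriv_pos (convex_Icc _ _) hν.contDiffOn.continuousOn fun x hx => ?_
    obtain ⟨c, hc, h⟩ := hν.deriv_lower
    have hx' : x ∈ Icc N₀ N₁ := interior_subset hx
    rw [← derivWithin_of_mem_nhds (mem_interior_iff_mem_nhds.1 hx)]
    exact hc.trans_le (h x hx')
  have hmem : N ∈ Icc N₀ N₁ := ⟨hN.1.le, hN.2.le.trans hν.N₁_pos.le⟩
  constructor
  · rw [← hν.eq_of_le N₀ le_rfl]
    exact hmono (left_mem_Icc.2 h01.le) hmem hN.1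
  · rw [← hν.map_zero]
    exact hmono hmem ⟨hν.N₀_neg.le, hν.N₁_pos.le⟩ hN.2

end IsStretchLimited

/-! ### Perturbation argument and main theorem -/

/-- For small mass density the scaled compressive problem has exactly one solution; it is close to
the inextensible one. -/
theorem exists_unique_supportMap_eq {ν : ℝ → ℝ} {ν₀ L : ℝ} (hν₀ : ∀ r, ν₀ ≤ ν r) (hL : 0 ≤ L)
    (hlip : ∀ r r', |ν r - ν r'| ≤ L * |r - r'|) (hν0 : ν 0 = 1) {g : ℝ} (hg : 0 < g) {p z₀ : ℂ}
    (hp : ‖p‖ < ν₀) (hz₀ : 0 < z₀.re) (hsol : supportMap (fun _ => 1) g 1 z₀ = p) :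
    ∃ ε C R : ℝ, 0 < ε ∧ ∃ Z : ℝ → ℂ, ∀ γ ∈ Ioo 0 ε,
      (∀ z : ℂ, (0 < z.re ∧ supportMap ν g γ z = p) ↔ z = Z γ) ∧
      ‖Z γ - z₀‖ ≤ C * γ ∧ ‖Z γ‖ ≤ R := by
  have hν : Continuous ν := (LipschitzWith.of_dist_le_mul (K := ⟨L, hL⟩) hlip).continuous
  set ρ : ℝ := z₀.re / 2 with hρ
  have hρ0 : 0 < ρ := by positivity
  set R₁ : ℝ := g * (ν₀ + ‖p‖) / (ν₀ - ‖p‖) with hR₁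
  -- One radius for both the a priori bound on all solutions and the ball used for existence.
  set R : ℝ := max R₁ (‖z₀‖ + ρ) with hR
  have hball : ∀ z ∈ Metric.closedBall z₀ ρ, ρ ≤ z.re ∧ ‖z‖ ≤ R := by
    intro z hz
    have h1 : ‖z - z₀‖ ≤ ρ := mem_closedBall_iff_norm.1 hz
    constructor
    · have h2 := neg_le_of_abs_le ((Complex.abs_re_le_norm (z - z₀)).trans h1)
      rw [Complex.sub_re] at h2
      linarith
    · refine le_trans ?_ (le_max_right _ _)
      have : z = z₀ + (z - z₀) := by ring
      rw [this]
      exact (norm_add_le _ _).trans (by gcongr)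
  have hz₀ball : z₀ ∈ Metric.closedBall z₀ ρ := Metric.mem_closedBall_self hρ0.le
  have hRpos : 0 < R := (add_pos_of_nonneg_of_pos (norm_nonneg _) hρ0).trans_le (le_max_right _ _)
  obtain ⟨c, hc, hmono⟩ := exists_stronglyMonotone_supportMap_one (R := R) hg hρ0
  set M : ℝ := L * (R + g) with hM
  have hM0 : 0 ≤ M := by positivity
  have hdiff : ∀ γ : ℝ, 0 ≤ γ → ∀ z : ℂ, 0 < z.re → ‖z‖ ≤ R →
      ‖supportMap ν g γ z - supportMap (fun _ => 1) g 1 z‖ ≤ M * γ := by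
    intro γ hγ z hz hzR
    refine (norm_supportMap_sub_one_le hL hν hlip hν0 hg hγ 1 hz).trans ?_
    calc L * γ * (‖z‖ + g) ≤ L * γ * (R + g) := by gcongr
      _ = M * γ := by rw [hM]; ring
  have hclose : ∀ γ : ℝ, 0 ≤ γ → ∀ z : ℂ, 0 < z.re → supportMap ν g γ z = p →
      ‖z‖ ≤ R ∧ ‖z - z₀‖ ≤ M / c * γ := by
    intro γ hγ z hz h
    have hzR : ‖z‖ ≤ R := (norm_le_of_supportMap_eq hν hν₀ hg hz hp h).trans (le_max_left _ _)
    refine ⟨hzR, ?_⟩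
    -- Only `z₀` has to stay away from the imaginary axis; nothing beyond `0 < z.re` is known of
    -- `z`.
    have h1 := hmono 1 z z₀ hz (hball z₀ hz₀ball).1 hzR (hball z₀ hz₀ball).2
    have h2 := hdiff γ hγ z hz hzR
    rw [h, norm_sub_rev] at h2
    rw [hsol] at h1
    have h3 := h1.trans ((real_inner_le_norm _ _).trans
      (mul_le_mul_of_nonneg_right h2 (norm_nonneg (z - z₀))))
    rw [div_mul_eq_mul_div, le_div_iff₀ hc]
    by_contra! hcon
    have hpos : 0 < ‖z - z₀‖ := by
      by_contra! h0
      have : ‖z - z₀‖ = 0 := le_antisymm h0 (norm_nonneg _)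
      rw [this, zero_mul] at hcon
      exact absurd hcon (not_lt.2 (by positivity))
    nlinarith [mul_lt_mul_of_pos_right hcon hpos]
  obtain ⟨ε, hε, hε1, hε2⟩ : ∃ ε : ℝ, 0 < ε ∧ (∀ γ < ε, 6 * L * γ ≤ c) ∧
      ∀ γ < ε, 4 * M * γ ≤ c * ρ := by
    -- The first bound lets the perturbation consume at most half of `c`; the second makes the
    -- defect at `z₀` admissible for existence and traps all solutions in the ball. The `+ 1` covers
    -- `L = 0` and `M = 0`.
    refine ⟨min (c / (6 * L + 1)) (c * ρ / (4 * M + 1)), by positivity, fun γ hγ => ?_,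
      fun γ hγ => ?_⟩
    · have h := (lt_div_iff₀ (by positivity)).1 (hγ.trans_le (min_le_left _ _))
      rcases le_or_gt 0 γ with h0 | h0
      · linarith
      · nlinarith
    · have h := (lt_div_iff₀ (by positivity)).1 (hγ.trans_le (min_le_right _ _))
      rcases le_or_gt 0 γ with h0 | h0
      · linarith
      · nlinarith [mul_pos hc hρ0]
  have hmonoγ : ∀ γ ∈ Ioo 0 ε, ∀ z ∈ Metric.closedBall z₀ ρ, ∀ z' ∈ Metric.closedBall z₀ ρ,
      c / 2 * ‖z - z'‖ ^ 2 ≤ inner ℝ (supportMap ν g γ z - supportMap ν g γ z') (z - z') := by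
    intro γ hγ z hz z' hz'
    obtain ⟨hzρ, hzR⟩ := hball z hz
    obtain ⟨hzρ', hzR'⟩ := hball z' hz'
    have h1 := hmono 1 z z' (hρ0.trans_le hzρ) hzρ' hzR hzR'
    have h2 := norm_supportMap_sub_one_sub_le hν hlip hν0 hγ.1.le (g := g) 1 (hρ0.trans_le hzρ)
      (hρ0.trans_le hzρ')
    set D := (supportMap ν g γ z - supportMap (fun _ => 1) g 1 z)
      - (supportMap ν g γ z' - supportMap (fun _ => 1) g 1 z') with hD
    have e : supportMap ν g γ z - supportMap ν g γ z'
        = (supportMap (fun _ => 1) g 1 z - supportMap (fun _ => 1) g 1 z') + D := by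
      rw [hD]; ring
    rw [e, inner_add_left]
    have h3 := neg_le_of_abs_le (abs_real_inner_le_norm D (z - z'))
    have h4 := mul_le_mul_of_nonneg_right h2 (norm_nonneg (z - z'))
    have h5 := mul_le_mul_of_nonneg_right (hε1 γ hγ.2) (sq_nonneg ‖z - z'‖)
    nlinarith
  have hexists : ∀ γ ∈ Ioo 0 ε, ∃ z ∈ Metric.closedBall z₀ ρ, supportMap ν g γ z = p := by
    intro γ hγ
    refine exists_eq_of_stronglyMonotone (K := 2 / ρ + 3 * (L * γ)) hρ0.le (half_pos hc)
      (hmonoγ γ hγ) (fun z hz z' hz' => ?_) ?_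
    · have hzρ := (hball z hz).1
      have hzρ' := (hball z' hz').1
      have h1 := norm_supportMap_one_sub_le g 1 hρ0 (hρ0.trans_le hzρ) hzρ'
      have h2 := norm_supportMap_sub_one_sub_le hν hlip hν0 hγ.1.le (g := g) 1 (hρ0.trans_le hzρ)
        (hρ0.trans_le hzρ')
      have e : supportMap ν g γ z - supportMap ν g γ z'
          = (supportMap (fun _ => 1) g 1 z - supportMap (fun _ => 1) g 1 z')
            + ((supportMap ν g γ z - supportMap (fun _ => 1) g 1 z)
              - (supportMap ν g γ z' - supportMap (fun _ => 1) g 1 z')) := by ring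
      rw [e, add_mul]
      exact (norm_add_le _ _).trans (add_le_add h1 h2)
    · have h1 := hdiff γ hγ.1.le z₀ hz₀ (hball z₀ hz₀ball).2
      rw [hsol] at h1
      have h2 := hε2 γ hγ.2
      linarith
  choose! Z hZball hZ using hexists
  refine ⟨ε, M / c, R, hε, Z, fun γ hγ => ?_⟩
  have hZre : 0 < (Z γ).re := hρ0.trans_le (hball _ (hZball γ hγ)).1
  obtain ⟨hZR, hZz₀⟩ := hclose γ hγ.1.le _ hZre (hZ γ hγ)
  refine ⟨fun z => ⟨fun ⟨hz, h⟩ => ?_, fun h => h ▸ ⟨hZre, hZ γ hγ⟩⟩, hZz₀, hZR⟩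
  have hzball : z ∈ Metric.closedBall z₀ ρ := by
    rw [mem_closedBall_iff_norm]
    refine (hclose γ hγ.1.le z hz h).2.trans ?_
    rw [div_mul_eq_mul_div, div_le_iff₀ hc]
    have := hε2 γ hγ.2
    have : 0 ≤ M * γ := mul_nonneg hM0 hγ.1.le
    linarith
  have h1 := hmonoγ γ hγ z hzball _ (hZball γ hγ)
  rw [h, hZ γ hγ, sub_self, inner_zero_left] at h1
  have h2 : ‖z - Z γ‖ ^ 2 ≤ 0 := by
    by_contra! hcon
    exact absurd h1 (not_le.2 (by positivity))
  exact sub_eq_zero.1 (norm_eq_zero.1 (pow_eq_zero_iff two_ne_zero |>.1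
    (le_antisymm h2 (sq_nonneg _))))

theorem solvesCompressive_iff {ν : ℝ → ℝ} (hν : Continuous ν) {g γ a b lam mu : ℝ}
    (hγ : 0 < γ) :
    (lam < 0 ∧ SolvesCompressive ν g γ a b lam mu) ↔
      (0 < (⟨-lam / γ, -mu / γ⟩ : ℂ).re ∧ supportMap ν g γ ⟨-lam / γ, -mu / γ⟩ = ⟨a, b⟩) := by
  have hre : 0 < (⟨-lam / γ, -mu / γ⟩ : ℂ).re ↔ lam < 0 := by
    simp only [div_pos_iff_of_pos_right hγ, neg_pos]
  rw [hre]
  refine and_congr_right fun hlam => ?_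
  have e1 : -(γ * (-lam / γ)) = lam := by field_simp
  have e2 : -(γ * (-mu / γ)) = mu := by field_simp
  have h := solvesCompressive_iff_supportMap (a := a) (b := b) hν (g := g) hγ (hre.2 hlam)
  simp only [e1, e2] at h
  exact h

/-- Uniqueness is read off from strong monotonicity, so it needs no discussion of the roots of `sinh
θ = kθ`. -/
theorem existsUnique_inextensible {g a b : ℝ} (hg : 0 < g) (ha : 0 < a) (hab : a ^ 2 + b ^ 2 < 1) :
    ∃ lam₀ mu₀ : ℝ,
      (∀ lam mu : ℝ, (lam < 0 ∧ SolvesInextensible g 1 a b lam mu) ↔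
        (lam = lam₀ ∧ mu = mu₀)) ∧
      (∀ lam mu : ℝ, (lam < 0 ∧ ExplicitInextensible g 1 a b lam mu) ↔
        (lam = lam₀ ∧ mu = mu₀)) := by
  have hb : b ^ 2 < 1 := by nlinarith
  obtain ⟨lam₀, mu₀, hlam₀, hexp⟩ := exists_explicitInextensible hg ha hab
  have hsol₀ := (solvesInextensible_iff_explicit hg ha hb hlam₀).2 hexp
  have key : ∀ lam mu : ℝ, (lam < 0 ∧ SolvesInextensible g 1 a b lam mu) ↔
      (lam = lam₀ ∧ mu = mu₀) := by
    intro lam mu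
    refine ⟨fun h => ?_, fun ⟨h1, h2⟩ => h1 ▸ h2 ▸ ⟨hlam₀, hsol₀⟩⟩
    obtain ⟨hz, hs⟩ := (solvesCompressive_iff continuous_const one_pos).1 h
    obtain ⟨hz₀, hs₀⟩ := (solvesCompressive_iff continuous_const one_pos).1 ⟨hlam₀, hsol₀⟩
    set z : ℂ := ⟨-lam / 1, -mu / 1⟩ with hzdef
    set z₀ : ℂ := ⟨-lam₀ / 1, -mu₀ / 1⟩ with hz₀def
    obtain ⟨c, hc, hmono⟩ :=
      exists_stronglyMonotone_supportMap_one (R := max ‖z‖ ‖z₀‖) hg hz₀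
    have h1 := hmono 1 z z₀ hz le_rfl (le_max_left _ _) (le_max_right _ _)
    rw [hs, hs₀, sub_self, inner_zero_left] at h1
    have h2 : ‖z - z₀‖ ^ 2 ≤ 0 := by
      by_contra! hcon
      exact absurd h1 (not_le.2 (by positivity))
    have h3 : z = z₀ := sub_eq_zero.1 (norm_eq_zero.1 (pow_eq_zero_iff two_ne_zero |>.1
      (le_antisymm h2 (sq_nonneg _))))
    rw [hzdef, hz₀def, Complex.mk.injEq] at h3
    simp only [div_one, neg_inj] at h3
    exact h3
  refine ⟨lam₀, mu₀, key, fun lam mu => ?_⟩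
  rw [← key lam mu]
  exact and_congr_right fun h => (solvesInextensible_iff_explicit hg ha hb h).symm

theorem mainTheorem1 (νhat : ℝ → ℝ) (N₀ N₁ ν₀ ν₁ : ℝ)
    (hν : IsStretchLimited νhat N₀ N₁ ν₀ ν₁)
    (g : ℝ) (hg : 0 < g) (a b : ℝ) (ha : 0 < a) (hab : a ^ 2 + b ^ 2 < ν₀ ^ 2) :
    ∃ lam₀ mu₀ : ℝ,
      -- `(lam₀, mu₀)` is the unique inextensible solution with unit mass density,
      -- and it is given by the explicit relations
      (∀ lam mu : ℝ, (lam < 0 ∧ SolvesInextensible g 1 a b lam mu) ↔ (lam = lam₀ ∧ mu = mu₀)) ∧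
      (∀ lam mu : ℝ, (lam < 0 ∧ ExplicitInextensible g 1 a b lam mu) ↔ (lam = lam₀ ∧ mu = mu₀)) ∧
      ∃ ε : ℝ, 0 < ε ∧ ∃ lamHat muHat : ℝ → ℝ,
        -- existence and uniqueness of the compressive state for small mass density
        (∀ γ ∈ Ioo 0 ε, ∀ lam mu : ℝ,
          (lam < 0 ∧ SolvesCompressive νhat g γ a b lam mu) ↔
            (lam = lamHat γ ∧ mu = muHat γ)) ∧
        (fun γ => lamHat γ - γ * lam₀) =O[𝓝[>] 0] (fun γ => γ ^ 2) ∧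
        (fun γ => muHat γ - γ * mu₀) =O[𝓝[>] 0] (fun γ => γ ^ 2) ∧
        -- complete extensibility
        (∀ γ ∈ Ioo 0 ε, ∀ s ∈ Icc (0 : ℝ) 1,
          compressiveStretch νhat g γ (lamHat γ) (muHat γ) s ∈ Ioo ν₀ 1) := by
  have hν₀pos := hν.ν₀_pos
  have hab1 : a ^ 2 + b ^ 2 < 1 := by nlinarith [hν.ν₀_lt_one]
  obtain ⟨lam₀, mu₀, hinext, hexp⟩ := existsUnique_inextensible hg ha hab1
  refine ⟨lam₀, mu₀, hinext, hexp, ?_⟩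
  obtain ⟨hz₀, hs₀⟩ := (solvesCompressive_iff continuous_const one_pos).1
    ((hinext lam₀ mu₀).2 ⟨rfl, rfl⟩)
  simp only [div_one] at hz₀ hs₀
  obtain ⟨L, hL, hlip⟩ := hν.exists_lipschitz
  have hcont : Continuous νhat := (LipschitzWith.of_dist_le_mul (K := ⟨L, hL⟩) hlip).continuous
  have hp : ‖(⟨a, b⟩ : ℂ)‖ < ν₀ := by
    refine lt_of_pow_lt_pow_left₀ 2 hν₀pos.le ?_
    rw [Complex.sq_norm, Complex.normSq_mk]
    linarith
  obtain ⟨ε, C, R, hε, Z, hZ⟩ := exists_unique_supportMap_eq hν.le_stretch hL hlip hν.map_zero hg hp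
    hz₀ hs₀
  set Q : ℝ := max R 0 + g with hQ
  have hQ0 : 0 < Q := add_pos_of_nonneg_of_pos (le_max_right _ _) hg
  have hN₀ : 0 < -N₀ := neg_pos.2 hν.N₀_neg
  have hO : ∀ (f : ℝ → ℝ), (∀ γ ∈ Ioo 0 ε, |f γ| ≤ γ * ‖Z γ - ⟨-lam₀, -mu₀⟩‖) →
      f =O[𝓝[>] 0] (fun γ => γ ^ 2) := by
    intro f hf
    refine IsBigO.of_bound C ?_
    filter_upwards [Ioo_mem_nhdsGT hε] with γ hγ
    rw [Real.norm_eq_abs, Real.norm_eq_abs, abs_of_nonneg (sq_nonneg γ)]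
    refine (hf γ hγ).trans ?_
    calc γ * ‖Z γ - ⟨-lam₀, -mu₀⟩‖ ≤ γ * (C * γ) :=
          mul_le_mul_of_nonneg_left (hZ γ hγ).2.1 hγ.1.le
      _ = C * γ ^ 2 := by ring
  -- All contact forces are at most `γQ` in magnitude, so `γ < -N₀/Q` keeps the tension above `N₀`.
  have hsub : Ioo 0 (min ε (-N₀ / Q)) ⊆ Ioo 0 ε := Ioo_subset_Ioo_right (min_le_left _ _)
  refine ⟨min ε (-N₀ / Q), lt_min hε (div_pos hN₀ hQ0), fun γ => -(γ * (Z γ).re),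
    fun γ => -(γ * (Z γ).im), fun γ hγ lam mu => ?_, hO _ fun γ hγ => ?_, hO _ fun γ hγ => ?_,
    fun γ hγ s hs => ?_⟩
  · have hγ0 := hγ.1.ne'
    rw [solvesCompressive_iff hcont hγ.1, (hZ γ (hsub hγ)).1, Complex.ext_iff,
      div_eq_iff hγ0, div_eq_iff hγ0, neg_eq_iff_eq_neg, neg_eq_iff_eq_neg]
    simp only [mul_comm γ]
  · have e : -(γ * (Z γ).re) - γ * lam₀ = -(γ * (Z γ - ⟨-lam₀, -mu₀⟩).re) := by
      rw [Complex.sub_re]; ring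
    rw [e, abs_neg, abs_mul, abs_of_pos hγ.1]
    exact mul_le_mul_of_nonneg_left (Complex.abs_re_le_norm _) hγ.1.le
  · have e : -(γ * (Z γ).im) - γ * mu₀ = -(γ * (Z γ - ⟨-lam₀, -mu₀⟩).im) := by
      rw [Complex.sub_im]; ring
    rw [e, abs_neg, abs_mul, abs_of_pos hγ.1]
    exact mul_le_mul_of_nonneg_left (Complex.abs_im_le_norm _) hγ.1.le
  · obtain ⟨huniq, -, hZR⟩ := hZ γ (hsub hγ)
    have hre := ((huniq (Z γ)).2 rfl).1
    refine hν.stretch_mem_Ioo ?_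
    rw [contactMagnitude_eq hγ.1.le]
    have hpos := mul_pos hγ.1 (norm_pos_iff.2 (scaledForce_ne_zero g hre s))
    have h1 : ‖scaledForce g (Z γ) s‖ ≤ Q :=
      (norm_scaledForce_le hg _ hs).trans (by rw [hQ]; gcongr; exact hZR.trans (le_max_left _ _))
    have h2 := (lt_div_iff₀ hQ0).1 (hγ.2.trans_le (min_le_right _ _))
    have h3 := mul_le_mul_of_nonneg_left h1 hγ.1.le
    exact ⟨by linarith, by linarith⟩
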